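/- Let $n\ge 0$ be an integer. A convex cone is a nonempty convex set closed under nonnegative scalar multiplication. A convex process is a set-valued map $H:\mathbb{R}^n\rightrightarrows\mathbb{R}^n$ whose graph $\{(x,y) : y\in H(x)\}$ is a convex cone. A state $\xi\in\mathbb{R}^n$ is feasible for $H$ if there is an infinite sequence $(x_k)_{k\in\mathbb{N}}$ with $x_0=\xi$ and $x_{k+1}\in H(x_k)$ for all $k\ge 0$; it is reachable if there are $q\in\mathbb{N}$ and $x_0,\dots,x_q$ with $x_0=0$, $x_q=\xi$ and $x_{k+1}\in H(x_k)$ for all $k<q$. The process $H$ is reachable if every feasible state is reachable. A set $\mathcal{D}\subseteq\mathbb{R}^n\times\mathbb{R}^n$ is informative for reachability if every convex process $H$ whose graph contains $\mathcal{D}$ is reachable. Theorem. Let $\mathcal{D}=\{(x_t,y_t) : t=1,\dots,T\}\subseteq\mathbb{R}^n\times\mathbb{R}^n$ be a finite set with $T=|\mathcal{D}|$ elements, and let $X=[x_1\ \cdots\ x_T]$ and $Y=[y_1\ \cdots\ y_T]$ in $\mathbb{R}^{n\times T}$. Let $Z,W\in\mathbb{R}^{\ell\times n}$ be any matrices such that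 the rows of $[Z\ \ {-W}]$, as vectors of $\mathbb{R}^{2n}$, generate the positive polar cone of $\mathcal{D}$, that is, the set $\{(p,q)\in\mathbb{R}^n\times\mathbb{R}^n : p^\top x+q^\top y\ge 0 \text{ for all } (x,y)\in\mathcal{D}\}$ is exactly the set of all nonnegative combinations of those rows. For $S\subseteq\mathbb{R}^n$ write $W^{-1}ZS=\{y\in\mathbb{R}^n : Wy\in ZS\}$ and $YX^{-1}S=\{Yv : v\in\mathbb{R}^T,\ Xv\in S\}$, and let $(W^{-1}Z)^n\{0\}$ and $(YX^{-1})^n\{0\}$ be the results of applying these operations $n$ times, starting from $\{0\}$. Suppose that $$X\mathbb{R}_+^T+(W^{-1}Z)^n\{0\}=\mathbb{R}^n .$$ Then $\mathcal{D}$ is informative for reachability if and only if $(YX^{-1})^n\{0\}=\mathbb{R}^n$ and, for all real $\lambda\ge 0$ and all $\xi\in\mathbb{R}^n$, $$\xi^\top(Y-\lambda X)\le 0\ \text{(entrywise)}\quad\Longrightarrow\quad \xi=0 .$$ -/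

import Mathlib

open scoped Pointwise

/-- A convex cone: a nonempty convex set closed under nonnegative scalar multiplication. -/
def IsConvexCone {E : Type*} [AddCommGroup E] [Module ℝ E] (C : Set E) : Prop :=
  C.Nonempty ∧ Convex ℝ C ∧ ∀ ρ : ℝ, 0 ≤ ρ → ∀ x ∈ C, ρ • x ∈ C

/-- A set-valued map from `ℝⁿ` to `ℝⁿ`. -/
abbrev SetValuedMap (n : ℕ) : Type := (Fin n → ℝ) → Set (Fin n → ℝ)

namespace SetValuedMap

variable {n : ℕ}

/-- The graph of a set-valued map. -/
def graph (H : SetValuedMap n) : Set ((Fin n → ℝ) × (Fin n → ℝ)) :=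
  {p | p.2 ∈ H p.1}

/-- A convex process is a set-valued map whose graph is a convex cone. -/
def IsConvexProc (H : SetValuedMap n) : Prop := IsConvexCone H.graph

/-- The `q`-step behavior: all `(x₀, …, x_q)` with `x_{k+1} ∈ H (x_k)` for all `k < q`. -/
def finiteBehavior (H : SetValuedMap n) (q : ℕ) : Set (Fin (q + 1) → (Fin n → ℝ)) :=
  {x | ∀ k : Fin q, x k.succ ∈ H (x k.castSucc)}

/-- The behavior: all infinite trajectories of `x_{k+1} ∈ H (x_k)`. -/
def behavior (H : SetValuedMap n) : Set (ℕ → (Fin n → ℝ)) :=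
  {x | ∀ k : ℕ, x (k + 1) ∈ H (x k)}

/-- The reachable set: end points of finite trajectories that start at the origin. -/
def reachableSet (H : SetValuedMap n) : Set (Fin n → ℝ) :=
  {ξ | ∃ q : ℕ, ∃ x ∈ H.finiteBehavior q, x 0 = 0 ∧ x (Fin.last q) = ξ}

/-- The feasible set: states from which an infinite trajectory emanates. -/
def feasibleSet (H : SetValuedMap n) : Set (Fin n → ℝ) :=
  {ξ | ∃ x ∈ H.behavior, x 0 = ξ}

/-- The system `x_{k+1} ∈ H (x_k)` is reachable if every feasible state is reachable. -/
def IsReachable (H : SetValuedMap n) : Prop := H.feasibleSet ⊆ H.reachableSet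

end SetValuedMap

/-- The data `D` are informative for reachability if every convex process whose graph
contains `D` is reachable. -/
def InformativeForReachability {n : ℕ} (D : Set ((Fin n → ℝ) × (Fin n → ℝ))) : Prop :=
  ∀ H : SetValuedMap n, H.IsConvexProc → D ⊆ H.graph → H.IsReachable

/-- The positive polar cone of a subset of `ℝⁿ × ℝⁿ`, for the standard inner product
`⟨(x, y), (p, q)⟩ = xᵀ p + yᵀ q`. -/
def positivePolar {n : ℕ} (C : Set ((Fin n → ℝ) × (Fin n → ℝ))) :
    Set ((Fin n → ℝ) × (Fin n → ℝ)) :=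
  {η | ∀ p ∈ C, 0 ≤ p.1 ⬝ᵥ η.1 + p.2 ⬝ᵥ η.2}

/-- The columns of `X` and `Y` enumerate the finite data set `D`, each pair once:
`D = {(x_t, y_t) : t = 1, …, T}` with `T = |D|`. -/
def IsDataMatrices {n T : ℕ} (D : Finset ((Fin n → ℝ) × (Fin n → ℝ)))
    (X Y : Matrix (Fin n) (Fin T) ℝ) : Prop :=
  D.card = T ∧
    (D : Set ((Fin n → ℝ) × (Fin n → ℝ))) = Set.range fun t => (X.col t, Y.col t)

/-- The rows `η_i` of the block matrix `[Z  -W]` generate the positive polar cone of `D`: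
`D⁺ = cone {η_1, …, η_ℓ}`. -/
def IsDualMatrices {n l : ℕ} (D : Set ((Fin n → ℝ) × (Fin n → ℝ)))
    (Z W : Matrix (Fin l) (Fin n) ℝ) : Prop :=
  positivePolar D =
    (PointedCone.hull ℝ (Set.range fun i => (Z.row i, -W.row i)) :
      Set ((Fin n → ℝ) × (Fin n → ℝ)))

/-- `X ℝ₊ᵀ`, the image of the nonnegative orthant. -/
def imageOrthant {n T : ℕ} (X : Matrix (Fin n) (Fin T) ℝ) : Set (Fin n → ℝ) :=
  X.mulVec '' {v | 0 ≤ v}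

/-- `(W⁻¹ Z)^k {0}`: `k` iterations, from `{0}`, of `S ↦ {y | W y ∈ Z S}`. -/
def iterPreimageImage {n l : ℕ} (W Z : Matrix (Fin l) (Fin n) ℝ) (k : ℕ) : Set (Fin n → ℝ) :=
  (fun S : Set (Fin n → ℝ) => W.mulVec ⁻¹' (Z.mulVec '' S))^[k] {0}

/-- `(Y X⁻¹)^k {0}`: `k` iterations, from `{0}`, of `S ↦ Y {v | X v ∈ S}`. -/
def iterImagePreimage {n T : ℕ} (Y X : Matrix (Fin n) (Fin T) ℝ) (k : ℕ) : Set (Fin n → ℝ) :=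
  (fun S : Set (Fin n → ℝ) => Y.mulVec '' (X.mulVec ⁻¹' S))^[k] {0}

/-! Necessity tests the data on two processes with full feasible set. A nonzero `ξ` violating the
spectral condition gives the half-space process `ξ·y ≤ λ ξ·x`, which starting from 0 never leaves
`ξ·x ≤ 0`. The subspace `P = (Y X⁻¹)ⁿ{0}` gives the linear hull of the data plus `P × P`, which
starting from 0 never leaves `P`.

For sufficiency, the reachable states of a process form a convex cone `R` that is invariant under
the data cone. By Farkas (`mem_dataCone_of_mulVec_eq`), `W⁻¹Z` lies in the data cone, so `R`
contains the subspace `N = (W⁻¹Z)ⁿ{0}`. Since `X ℝ₊ᵀ + N = ℝⁿ`, the span of `R` is invariant under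
`Y X⁻¹` (`mulVec_mem_span_of_invariant`); hence it is everything, and `R` has an interior point `X
v₀` with `v₀ ≥ 0`.

The spectral condition says dually that `λX - Y` maps the nonnegative orthant onto `ℝⁿ` for every `λ
≥ 0`, with bounds uniform for bounded `λ` (`exists_bound_nonneg_solution`). This allows a solution
`v ≥ 0` of `λXv - Yv = s`, with `s` interior to `R` and `Xv ∈ R`, to be continued from a large `λ`
down to 0 (`eq_univ_of_dataCone_invariant`). There `-s = Yv ∈ R`, which forces `R = ℝⁿ`. -/

/-! ### Farkas' lemma and the data cone -/

/-- Farkas' lemma for finitely many linear functionals. -/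
theorem exists_nonneg_sum_of_forall_nonpos {V : Type*} [AddCommGroup V] [Module ℝ V] (m : ℕ) :
    ∀ (α : Fin m → V →ₗ[ℝ] ℝ) (γ : V →ₗ[ℝ] ℝ),
      (∀ x, (∀ i, α i x ≤ 0) → γ x ≤ 0) →
        ∃ c : Fin m → ℝ, 0 ≤ c ∧ γ = ∑ i, c i • α i := by
  induction m with
  | zero =>
    intro α γ h
    refine ⟨0, le_rfl, ?_⟩
    ext x
    have h1 := h x (fun i => i.elim0)
    have h2 := h (-x) (fun i => i.elim0)
    simp only [map_neg] at h2
    simp only [Finset.univ_eq_empty, Finset.sum_empty, LinearMap.zero_apply]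
    linarith
  | succ m ih =>
    intro α γ h
    by_cases hm : ∀ x, (∀ i : Fin m, α i.castSucc x ≤ 0) → γ x ≤ 0
    · obtain ⟨c, hc, hγ⟩ := ih (fun i => α i.castSucc) γ hm
      refine ⟨Fin.snoc c 0, fun i => ?_, ?_⟩
      · refine Fin.lastCases ?_ (fun j => ?_) i
        · simp
        · simpa using hc j
      · rw [Fin.sum_univ_castSucc]
        simpa using hγ
    · push Not at hm
      obtain ⟨z, hz, hγz⟩ := hm
      have hlast : 0 < α (Fin.last m) z := by
        by_contra hcon
        refine absurd (h z fun i => ?_) (not_le.2 hγz)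
        exact Fin.lastCases (not_lt.1 hcon) hz i
      set β := α (Fin.last m) with hβ
      -- The last constraint is not redundant. Project along `z` onto `ker β`: the corrected
      -- functionals at `x` are the original ones at `x - (β x / β z) • z`.
      obtain ⟨c, hc, hγ⟩ := ih
        (fun i => α i.castSucc - (α i.castSucc z / β z) • β) (γ - (γ z / β z) • β) (by
          intro x hx
          have h0 := h (x - (β x / β z) • z) (fun i => by
            refine Fin.lastCases ?_ (fun j => ?_) i
            · rw [← hβ]
              simp only [map_sub, map_smul, smul_eq_mul]
              rw [div_mul_cancel₀ _ hlast.ne', sub_self]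
            · have := hx j
              simp only [LinearMap.sub_apply, LinearMap.smul_apply, smul_eq_mul] at this
              simp only [map_sub, map_smul, smul_eq_mul]
              calc _ = _ := by ring
                _ ≤ 0 := this)
          simp only [map_sub, map_smul, smul_eq_mul] at h0
          simp only [LinearMap.sub_apply, LinearMap.smul_apply, smul_eq_mul]
          calc _ = _ := by ring
            _ ≤ 0 := h0)
      refine ⟨Fin.snoc c (γ z / β z - ∑ i, c i * (α i.castSucc z / β z)), fun i => ?_, ?_⟩
      · refine Fin.lastCases ?_ (fun j => ?_) i
        · have h1 : ∑ i, c i * (α i.castSucc z / β z) ≤ 0 :=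
            Finset.sum_nonpos fun i _ => mul_nonpos_of_nonneg_of_nonpos (hc i)
              (div_nonpos_of_nonpos_of_nonneg (hz i) hlast.le)
          have h2 : 0 < γ z / β z := div_pos hγz hlast
          simp only [Pi.zero_apply, Fin.snoc_last]
          linarith
        · simpa using hc j
      · rw [Fin.sum_univ_castSucc]
        simp only [Fin.snoc_castSucc, Fin.snoc_last]
        rw [← hβ]
        ext x
        have h := congrArg (fun f => f x) hγ
        simp only [LinearMap.sub_apply, LinearMap.add_apply, LinearMap.sum_apply,
          LinearMap.smul_apply, smul_eq_mul, mul_sub, Finset.sum_sub_distrib, ← mul_assoc,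
          ← Finset.sum_mul] at h ⊢
        linarith

/-- The convex cone generated by the columns of the stacked matrix `[X; Y]`. -/
def dataCone {n T : ℕ} (X Y : Matrix (Fin n) (Fin T) ℝ) : Set ((Fin n → ℝ) × (Fin n → ℝ)) :=
  {p | ∃ v : Fin T → ℝ, 0 ≤ v ∧ p = (X.mulVec v, Y.mulVec v)}

theorem mulVec_eq_sum_col {n T : ℕ} (X : Matrix (Fin n) (Fin T) ℝ) (v : Fin T → ℝ) :
    X.mulVec v = ∑ t, v t • X.col t := by
  ext i
  simp [Matrix.mulVec, dotProduct, Matrix.col, mul_comm]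

theorem IsConvexCone.zero_mem {E : Type*} [AddCommGroup E] [Module ℝ E] {C : Set E}
    (hC : IsConvexCone C) : (0 : E) ∈ C := by
  obtain ⟨⟨x, hx⟩, -, h⟩ := hC
  simpa using h 0 le_rfl x hx

theorem IsConvexCone.add_mem {E : Type*} [AddCommGroup E] [Module ℝ E] {C : Set E}
    (hC : IsConvexCone C) {x y : E} (hx : x ∈ C) (hy : y ∈ C) : x + y ∈ C := by
  have h := hC.2.2 2 (by norm_num) _
    (hC.2.1 hx hy (by norm_num : (0 : ℝ) ≤ 1 / 2) (by norm_num : (0 : ℝ) ≤ 1 / 2) (by norm_num))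
  rw [smul_add, smul_smul, smul_smul] at h
  norm_num at h
  exact h

theorem isConvexCone_of_add_smul {E : Type*} [AddCommGroup E] [Module ℝ E] {C : Set E}
    (h0 : (0 : E) ∈ C) (hadd : ∀ x ∈ C, ∀ y ∈ C, x + y ∈ C)
    (hsmul : ∀ ρ : ℝ, 0 ≤ ρ → ∀ x ∈ C, ρ • x ∈ C) : IsConvexCone C :=
  ⟨⟨0, h0⟩, fun _ hx _ hy _ _ ha hb _ => hadd _ (hsmul _ ha _ hx) _ (hsmul _ hb _ hy), hsmul⟩

theorem dataCone_subset_of_isConvexCone {n T : ℕ} {D : Finset ((Fin n → ℝ) × (Fin n → ℝ))}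
    {X Y : Matrix (Fin n) (Fin T) ℝ} (hXY : IsDataMatrices D X Y)
    {C : Set ((Fin n → ℝ) × (Fin n → ℝ))} (hC : IsConvexCone C)
    (hDC : (D : Set ((Fin n → ℝ) × (Fin n → ℝ))) ⊆ C) : dataCone X Y ⊆ C := by
  rintro _ ⟨v, hv, rfl⟩
  have hsum : (X.mulVec v, Y.mulVec v) = ∑ t, v t • (X.col t, Y.col t) := by
    ext1
    · simp [Prod.fst_sum, mulVec_eq_sum_col]
    · simp [Prod.snd_sum, mulVec_eq_sum_col]
  rw [hsum]
  refine Finset.sum_induction _ (· ∈ C) (fun _ _ => hC.add_mem) hC.zero_mem fun t _ => ?_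
  refine hC.2.2 _ (hv t) _ (hDC ?_)
  rw [hXY.2]
  exact ⟨t, rfl⟩

/-- The functional `(p, q) ↦ x ⬝ p + y ⬝ q`. -/
def pairFunctional {n : ℕ} (x : (Fin n → ℝ) × (Fin n → ℝ)) :
    ((Fin n → ℝ) × (Fin n → ℝ)) →ₗ[ℝ] ℝ :=
  (dotProductEquiv ℝ (Fin n) x.1).coprod (dotProductEquiv ℝ (Fin n) x.2)

@[simp] theorem pairFunctional_apply {n : ℕ} (x p : (Fin n → ℝ) × (Fin n → ℝ)) :
    pairFunctional x p = x.1 ⬝ᵥ p.1 + x.2 ⬝ᵥ p.2 := rfl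

/-- The linear process `W⁻¹ Z` is contained in the data cone. -/
theorem mem_dataCone_of_mulVec_eq {n T l : ℕ} {D : Finset ((Fin n → ℝ) × (Fin n → ℝ))}
    {X Y : Matrix (Fin n) (Fin T) ℝ} (hXY : IsDataMatrices D X Y)
    {Z W : Matrix (Fin l) (Fin n) ℝ}
    (hZW : IsDualMatrices (D : Set ((Fin n → ℝ) × (Fin n → ℝ))) Z W)
    {p : (Fin n → ℝ) × (Fin n → ℝ)} (hp : Z.mulVec p.1 = W.mulVec p.2) :
    p ∈ dataCone X Y := by
  -- Bipolar argument: `hp` makes `p` orthogonal to every generator of the polar cone, hence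
  -- nonnegative on that cone.
  obtain ⟨c, hc, h⟩ := exists_nonneg_sum_of_forall_nonpos T
    (fun t => -pairFunctional (X.col t, Y.col t)) (-pairFunctional p) (by
      intro η hη
      have hmem : η ∈ positivePolar (D : Set ((Fin n → ℝ) × (Fin n → ℝ))) := by
        intro d hd
        rw [hXY.2] at hd
        obtain ⟨t, rfl⟩ := hd
        have := hη t
        simp only [LinearMap.neg_apply, pairFunctional_apply] at this
        linarith
      rw [hZW] at hmem
      have hzero : pairFunctional p η = 0 := by
        refine Submodule.span_induction (p := fun η _ => pairFunctional p η = 0) ?_ (map_zero _)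
          (fun a b _ _ ha hb => by rw [map_add, ha, hb, add_zero])
          (fun r a _ ha => ?_) hmem
        · rintro _ ⟨i, rfl⟩
          have := congrFun hp i
          simp only [Matrix.mulVec] at this
          simp only [pairFunctional_apply, dotProduct_neg]
          rw [dotProduct_comm p.1, dotProduct_comm p.2]
          exact add_neg_eq_zero.2 this
        · change pairFunctional p ((r : ℝ) • a) = 0
          rw [map_smul, ha, smul_zero]
      simp [hzero])
  refine ⟨c, hc, ?_⟩
  have key : ∀ η, pairFunctional p η = pairFunctional (X.mulVec c, Y.mulVec c) η := by
    intro η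
    have := congrArg (fun f => f η) h
    simp only [LinearMap.neg_apply, LinearMap.sum_apply, LinearMap.smul_apply, smul_eq_mul,
      mul_neg, Finset.sum_neg_distrib, neg_inj] at this
    rw [this]
    simp only [pairFunctional_apply, mulVec_eq_sum_col, sum_dotProduct, smul_dotProduct,
      smul_eq_mul, mul_add, Finset.sum_add_distrib]
  ext i
  · simpa using key (Pi.single i 1, 0)
  · simpa using key (0, Pi.single i 1)

/-! ### Iterated reachable sets -/

section ReachIter

variable {n : ℕ}

/-- The states that can be reached from the origin in `k` steps along pairs in `G`. -/
def reachIter (G : Set ((Fin n → ℝ) × (Fin n → ℝ))) (k : ℕ) : Set (Fin n → ℝ) :=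
  (fun S : Set (Fin n → ℝ) => {y | ∃ x ∈ S, (x, y) ∈ G})^[k] {0}

theorem reachIter_zero (G : Set ((Fin n → ℝ) × (Fin n → ℝ))) : reachIter G 0 = {0} := rfl

theorem mem_reachIter_succ {G : Set ((Fin n → ℝ) × (Fin n → ℝ))} {k : ℕ} {y : Fin n → ℝ} :
    y ∈ reachIter G (k + 1) ↔ ∃ x ∈ reachIter G k, (x, y) ∈ G := by
  rw [reachIter, Function.iterate_succ_apply']
  rfl

theorem reachIter_subset {G : Set ((Fin n → ℝ) × (Fin n → ℝ))} {S : Set (Fin n → ℝ)}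
    (h0 : 0 ∈ S) (hS : ∀ x ∈ S, ∀ y, (x, y) ∈ G → y ∈ S) (k : ℕ) : reachIter G k ⊆ S := by
  induction k with
  | zero => simpa [reachIter_zero] using h0
  | succ k ih =>
    intro y hy
    obtain ⟨x, hx, hxy⟩ := mem_reachIter_succ.1 hy
    exact hS x (ih hx) y hxy

theorem reachIter_mono_left {G G' : Set ((Fin n → ℝ) × (Fin n → ℝ))} (h : G ⊆ G') (k : ℕ) :
    reachIter G k ⊆ reachIter G' k := by
  induction k with
  | zero => exact subset_rfl
  | succ k ih =>
    intro y hy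
    obtain ⟨x, hx, hxy⟩ := mem_reachIter_succ.1 hy
    exact mem_reachIter_succ.2 ⟨x, ih hx, h hxy⟩

theorem reachIter_monotone {G : Set ((Fin n → ℝ) × (Fin n → ℝ))} (h0 : (0, 0) ∈ G) :
    Monotone (reachIter G) := by
  refine monotone_nat_of_le_succ fun k => ?_
  induction k with
  | zero =>
    rintro _ rfl
    exact mem_reachIter_succ.2 ⟨0, rfl, h0⟩
  | succ k ih =>
    intro y hy
    obtain ⟨x, hx, hxy⟩ := mem_reachIter_succ.1 hy
    exact mem_reachIter_succ.2 ⟨x, ih hx, hxy⟩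

theorem reachIter_add {G : Set ((Fin n → ℝ) × (Fin n → ℝ))}
    (hG : ∀ p ∈ G, ∀ q ∈ G, p + q ∈ G) (k : ℕ) {x y : Fin n → ℝ} (hx : x ∈ reachIter G k)
    (hy : y ∈ reachIter G k) : x + y ∈ reachIter G k := by
  induction k generalizing x y with
  | zero =>
    rw [reachIter_zero, Set.mem_singleton_iff] at *
    rw [hx, hy, add_zero]
  | succ k ih =>
    obtain ⟨a, ha, hax⟩ := mem_reachIter_succ.1 hx
    obtain ⟨b, hb, hby⟩ := mem_reachIter_succ.1 hy
    exact mem_reachIter_succ.2 ⟨a + b, ih ha hb, hG _ hax _ hby⟩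

theorem reachIter_smul {G : Set ((Fin n → ℝ) × (Fin n → ℝ))} {c : ℝ}
    (hG : ∀ p ∈ G, c • p ∈ G) (k : ℕ) {x : Fin n → ℝ} (hx : x ∈ reachIter G k) :
    c • x ∈ reachIter G k := by
  induction k generalizing x with
  | zero =>
    rw [reachIter_zero, Set.mem_singleton_iff] at *
    rw [hx, smul_zero]
  | succ k ih =>
    obtain ⟨a, ha, hax⟩ := mem_reachIter_succ.1 hx
    exact mem_reachIter_succ.2 ⟨c • a, ih ha, hG _ hax⟩

theorem iterPreimageImage_eq_reachIter {l : ℕ} (W Z : Matrix (Fin l) (Fin n) ℝ) (k : ℕ) :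
    iterPreimageImage W Z k = reachIter {p | Z.mulVec p.1 = W.mulVec p.2} k := rfl

theorem iterImagePreimage_eq_reachIter {T : ℕ} (Y X : Matrix (Fin n) (Fin T) ℝ) (k : ℕ) :
    iterImagePreimage Y X k = reachIter (Set.range fun v => (X.mulVec v, Y.mulVec v)) k := by
  unfold iterImagePreimage reachIter
  congr 2
  funext S
  ext y
  constructor
  · rintro ⟨v, hv, rfl⟩
    exact ⟨_, hv, v, rfl⟩
  · rintro ⟨x, hx, v, hv⟩
    obtain ⟨rfl, rfl⟩ := Prod.mk.inj hv
    exact ⟨v, hx, rfl⟩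

/-- The iterates of a linear process from the origin, as subspaces. -/
def reachSubmodule (L : Submodule ℝ ((Fin n → ℝ) × (Fin n → ℝ))) : ℕ → Submodule ℝ (Fin n → ℝ)
  | 0 => ⊥
  | k + 1 => ((reachSubmodule L k).prod ⊤ ⊓ L).map (LinearMap.snd ℝ _ _)

theorem coe_reachSubmodule (L : Submodule ℝ ((Fin n → ℝ) × (Fin n → ℝ))) (k : ℕ) :
    (reachSubmodule L k : Set (Fin n → ℝ)) = reachIter (L : Set ((Fin n → ℝ) × (Fin n → ℝ))) k := by
  induction k with
  | zero => rfl
  | succ k ih =>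
    ext y
    rw [mem_reachIter_succ, ← ih]
    simp [reachSubmodule]

theorem reachSubmodule_monotone (L : Submodule ℝ ((Fin n → ℝ) × (Fin n → ℝ))) :
    Monotone (reachSubmodule L) := by
  intro a b hab
  rw [← SetLike.coe_subset_coe, coe_reachSubmodule, coe_reachSubmodule]
  exact reachIter_monotone L.zero_mem hab

/-- Until the increasing chain stabilises, each step raises the dimension by at least one, and the
dimension cannot exceed `n`. -/
theorem reachSubmodule_succ_eq (L : Submodule ℝ ((Fin n → ℝ) × (Fin n → ℝ))) :
    reachSubmodule L (n + 1) = reachSubmodule L n := by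
  have key : ∀ k, reachSubmodule L (k + 1) = reachSubmodule L k ∨
      k + 1 ≤ Module.finrank ℝ (reachSubmodule L (k + 1)) := by
    intro k
    induction k with
    | zero =>
      by_cases h : reachSubmodule L 1 = reachSubmodule L 0
      · exact .inl h
      · have := Submodule.finrank_lt_finrank_of_lt
          (lt_of_le_of_ne (reachSubmodule_monotone L (Nat.zero_le 1)) (Ne.symm h))
        exact .inr (by rw [zero_add]; exact Nat.succ_le_of_lt (Nat.zero_lt_of_lt this))
    | succ k ih =>
      rcases ih with ih | ih
      · exact .inl (congrArg (fun S : Submodule ℝ (Fin n → ℝ) =>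
          (S.prod ⊤ ⊓ L).map (LinearMap.snd ℝ _ _)) ih)
      · by_cases h : reachSubmodule L (k + 1 + 1) = reachSubmodule L (k + 1)
        · exact .inl h
        · have := Submodule.finrank_lt_finrank_of_lt
            (lt_of_le_of_ne (reachSubmodule_monotone L (Nat.le_add_right (k + 1) 1)) (Ne.symm h))
          exact .inr (by omega)
  rcases key n with h | h
  · exact h
  · have := Submodule.finrank_le (reachSubmodule L (n + 1))
    rw [Module.finrank_fin_fun] at this
    omega

namespace SetValuedMap

theorem zero_mem_reachableSet (H : SetValuedMap n) : 0 ∈ H.reachableSet :=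
  ⟨0, fun _ => 0, fun k => k.elim0, rfl, rfl⟩

theorem mem_reachableSet_of_step {H : SetValuedMap n} {x y : Fin n → ℝ}
    (hx : x ∈ H.reachableSet) (hxy : y ∈ H x) : y ∈ H.reachableSet := by
  obtain ⟨q, z, hz, hz0, hzq⟩ := hx
  refine ⟨q + 1, Fin.snoc (α := fun _ => Fin n → ℝ) z y, fun k => ?_, ?_, ?_⟩
  · refine Fin.lastCases ?_ (fun j => ?_) k
    · rw [Fin.succ_last, Fin.snoc_last, Fin.snoc_castSucc, hzq]
      exact hxy
    · rw [Fin.succ_castSucc, Fin.snoc_castSucc, Fin.snoc_castSucc]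
      exact hz j
  · rw [← Fin.castSucc_zero, Fin.snoc_castSucc, hz0]
  · rw [Fin.snoc_last]

theorem reachableSet_subset {H : SetValuedMap n} {S : Set (Fin n → ℝ)} (h0 : 0 ∈ S)
    (hS : ∀ x ∈ S, ∀ y ∈ H x, y ∈ S) : H.reachableSet ⊆ S := by
  rintro _ ⟨q, x, hx, hx0, rfl⟩
  have key : ∀ k : Fin (q + 1), x k ∈ S := by
    intro k
    induction k using Fin.induction with
    | zero => rwa [hx0]
    | succ k ih => exact hS _ ih _ (hx k)
  exact key _

theorem reachIter_graph_subset_reachableSet (H : SetValuedMap n) (k : ℕ) :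
    reachIter H.graph k ⊆ H.reachableSet :=
  reachIter_subset H.zero_mem_reachableSet (fun _ hx _ hxy => mem_reachableSet_of_step hx hxy) k

/-- If every value of `H` is nonempty, then every state is feasible. -/
theorem feasibleSet_eq_univ {H : SetValuedMap n} (h : ∀ x, (H x).Nonempty) :
    H.feasibleSet = Set.univ := by
  choose f hf using h
  refine Set.eq_univ_of_forall fun ξ => ⟨fun k => f^[k] ξ, fun k => ?_, rfl⟩
  change f^[k + 1] ξ ∈ H (f^[k] ξ)
  rw [Function.iterate_succ_apply']
  exact hf _

end SetValuedMap

end ReachIter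

/-! ### Uniformly bounded nonnegative solutions -/

theorem abs_dotProduct_le {n : ℕ} (ξ z : Fin n → ℝ) : |ξ ⬝ᵥ z| ≤ n * (‖ξ‖ * ‖z‖) := by
  calc |ξ ⬝ᵥ z| ≤ ∑ i, |ξ i * z i| := Finset.abs_sum_le_sum_abs _ _
    _ ≤ ∑ _i : Fin n, ‖ξ‖ * ‖z‖ := Finset.sum_le_sum fun i _ => by
        rw [abs_mul]
        exact mul_le_mul (norm_le_pi_norm ξ i) (norm_le_pi_norm z i) (abs_nonneg _) (norm_nonneg _)
    _ = n * (‖ξ‖ * ‖z‖) := by simp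

/-- If the support function of the zonotope `A [0, 1]ᵀ` dominates `m ‖ξ‖`, then the zonotope
contains a ball around the origin. -/
theorem exists_mem_Icc_mulVec_eq {n T : ℕ} (A : Matrix (Fin n) (Fin T) ℝ) {m : ℝ}
    (hA : ∀ ξ : Fin n → ℝ, m * ‖ξ‖ ≤ ∑ t, max 0 (Matrix.vecMul ξ A t))
    {z : Fin n → ℝ} (hz : n * ‖z‖ ≤ m) : ∃ v ∈ Set.Icc (0 : Fin T → ℝ) 1, A.mulVec v = z := by
  by_contra hcon
  have hcont : Continuous A.mulVec := Continuous.matrix_mulVec continuous_const continuous_id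
  have hconv : Convex ℝ (A.mulVec '' Set.Icc 0 1) :=
    (convex_Icc (0 : Fin T → ℝ) 1).linear_image A.mulVecLin
  obtain ⟨f, u, hfu, huz⟩ := geometric_hahn_banach_closed_point hconv
    (isCompact_Icc.image hcont).isClosed (x := z) (fun ⟨v, hv, h⟩ => hcon ⟨v, hv, h⟩)
  obtain ⟨ξ, hξ⟩ : ∃ ξ : Fin n → ℝ, ∀ x, f x = ξ ⬝ᵥ x := by
    obtain ⟨ξ, hξ⟩ := (dotProductEquiv ℝ (Fin n)).surjective f.toLinearMap
    exact ⟨ξ, fun x => (congrArg (fun g => g x) hξ).symm⟩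
  -- The vertex of the cube at which `ξ · A v` attains the support function.
  set v : Fin T → ℝ := fun t => if 0 < Matrix.vecMul ξ A t then 1 else 0 with hv
  have hvmem : v ∈ Set.Icc (0 : Fin T → ℝ) 1 := by
    constructor <;> intro t <;> simp only [hv, Pi.zero_apply, Pi.one_apply] <;> split_ifs <;> norm_num
  have h1 : f (A.mulVec v) = ∑ t, max 0 (Matrix.vecMul ξ A t) := by
    rw [hξ, Matrix.dotProduct_mulVec]
    refine Finset.sum_congr rfl fun t _ => ?_
    simp only [hv]
    split_ifs with h
    · rw [max_eq_right h.le, mul_one]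
    · rw [max_eq_left (not_lt.1 h), mul_zero]
  have h2 := hfu _ ⟨v, hvmem, rfl⟩
  rw [h1] at h2
  rw [hξ] at huz
  have h3 := (le_abs_self _).trans (abs_dotProduct_le ξ z)
  have h4 := hA ξ
  have h5 : n * (‖ξ‖ * ‖z‖) ≤ m * ‖ξ‖ := by
    calc n * (‖ξ‖ * ‖z‖) = (n * ‖z‖) * ‖ξ‖ := by ring
      _ ≤ m * ‖ξ‖ := mul_le_mul_of_nonneg_right hz (norm_nonneg _)
  linarith

/-- The support function of the zonotope `(λX - Y)[0,1]ᵀ` is positive on the unit sphere by `hspec`.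
Compactness in `(ξ, λ)` bounds it below uniformly, so all these zonotopes contain a common ball, and
scaling reaches every `z`. -/
theorem exists_bound_nonneg_solution {n T : ℕ} {X Y : Matrix (Fin n) (Fin T) ℝ}
    (hspec : ∀ lam : ℝ, 0 ≤ lam → ∀ ξ : Fin n → ℝ, Matrix.vecMul ξ (Y - lam • X) ≤ 0 → ξ = 0)
    (Λ : ℝ) :
    ∃ C : ℝ, 0 < C ∧ ∀ lam ∈ Set.Icc 0 Λ, ∀ z : Fin n → ℝ, ∃ w : Fin T → ℝ, 0 ≤ w ∧
      (lam • X - Y).mulVec w = z ∧ ‖X.mulVec w‖ ≤ C * ‖z‖ := by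
  have hcont : Continuous fun p : (Fin n → ℝ) × ℝ =>
      ∑ t, max 0 (Matrix.vecMul p.1 (p.2 • X - Y) t) := by
    refine continuous_finsetSum _ fun t _ => continuous_const.max ?_
    refine (continuous_apply t).comp (Continuous.matrix_vecMul continuous_fst ?_)
    fun_prop
  have hcompact : IsCompact (Metric.sphere (0 : Fin n → ℝ) 1 ×ˢ Set.Icc 0 Λ) :=
    (isCompact_sphere _ _).prod isCompact_Icc
  obtain ⟨m, hm, hmin⟩ := hcompact.exists_forall_le' hcont.continuousOn (a := 0) (by
    rintro ⟨ξ, lam⟩ ⟨hξ, hlam⟩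
    have hξ0 : ξ ≠ 0 := by
      rintro rfl
      simp at hξ
    by_contra hcon
    have hz : ∀ t, max 0 (Matrix.vecMul ξ (lam • X - Y) t) = 0 := by
      intro t
      refine (Finset.sum_eq_zero_iff_of_nonneg (fun t _ => le_max_left _ _)).1
        (le_antisymm (not_lt.1 hcon) (Finset.sum_nonneg fun t _ => le_max_left _ _)) t
        (Finset.mem_univ t)
    refine hξ0 (neg_eq_zero.1 (hspec lam hlam.1 (-ξ) fun t => ?_))
    have h := max_eq_left_iff.1 (hz t)
    rwa [← neg_sub, Matrix.neg_vecMul, Matrix.vecMul_neg, neg_neg])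
  have hhom : ∀ lam ∈ Set.Icc 0 Λ, ∀ ξ : Fin n → ℝ,
      m * ‖ξ‖ ≤ ∑ t, max 0 (Matrix.vecMul ξ (lam • X - Y) t) := by
    intro lam hlam ξ
    by_cases hξ : ξ = 0
    · simp [hξ]
    have hpos : 0 < ‖ξ‖ := norm_pos_iff.2 hξ
    have h := hmin (‖ξ‖⁻¹ • ξ, lam) ⟨by simp [norm_smul, hpos.ne'], hlam⟩
    calc m * ‖ξ‖ ≤ (∑ t, max 0 (Matrix.vecMul (‖ξ‖⁻¹ • ξ) (lam • X - Y) t)) * ‖ξ‖ :=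
          mul_le_mul_of_nonneg_right h hpos.le
      _ = _ := by
        rw [Finset.sum_mul]
        refine Finset.sum_congr rfl fun t _ => ?_
        rw [max_mul_of_nonneg _ _ hpos.le, zero_mul, Matrix.smul_vecMul, Pi.smul_apply,
          smul_eq_mul, mul_comm, mul_inv_cancel_left₀ hpos.ne']
  have hX : Continuous X.mulVec := Continuous.matrix_mulVec continuous_const continuous_id
  obtain ⟨B, hB, hXB⟩ :=
    ((isCompact_Icc (a := (0 : Fin T → ℝ)) (b := 1)).image hX).isBounded.exists_pos_norm_le
  refine ⟨B * ((n + 1) / m), by positivity, fun lam hlam z => ?_⟩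
  by_cases hz : z = 0
  · exact ⟨0, le_rfl, by simp [hz], by simp [hz]⟩
  have hzpos : 0 < ‖z‖ := norm_pos_iff.2 hz
  -- Chosen so that `n * ‖r • z‖ ≤ m`; `n + 1` keeps the denominator positive when `n = 0`.
  set r : ℝ := m / ((n + 1) * ‖z‖) with hr
  have hrpos : 0 < r := by positivity
  obtain ⟨v, hv, hvz⟩ := exists_mem_Icc_mulVec_eq (lam • X - Y) (hhom lam hlam) (z := r • z) (by
    rw [norm_smul, Real.norm_of_nonneg hrpos.le, hr]
    have : (n : ℝ) * (m / ((n + 1) * ‖z‖) * ‖z‖) = n / (n + 1) * m := by field_simp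
    rw [this]
    refine mul_le_of_le_one_left hm.le ?_
    rw [div_le_one (by positivity)]
    linarith)
  refine ⟨r⁻¹ • v, smul_nonneg (by positivity) hv.1, ?_, ?_⟩
  · rw [Matrix.mulVec_smul, hvz, inv_smul_smul₀ hrpos.ne']
  · rw [Matrix.mulVec_smul, norm_smul, Real.norm_of_nonneg (by positivity)]
    calc r⁻¹ * ‖X.mulVec v‖ ≤ r⁻¹ * B :=
          mul_le_mul_of_nonneg_left (hXB _ ⟨v, hv, rfl⟩) (by positivity)
      _ = B * ((n + 1) / m) * ‖z‖ := by rw [hr, inv_div]; ring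

/-! ### Continuation in `λ` -/

/-- A convex cone that contains the negative of one of its interior points
is the whole space. -/
theorem IsConvexCone.eq_univ_of_neg_interior_mem {E : Type*} [NormedAddCommGroup E]
    [NormedSpace ℝ E] {R : Set E} (hR : IsConvexCone R) {s : E} (hs : s ∈ interior R)
    (hs' : -s ∈ R) : R = Set.univ := by
  refine Set.eq_univ_of_forall fun e => ?_
  obtain ⟨ε, hε, hball⟩ := Metric.mem_nhds_iff.1 (mem_interior_iff_mem_nhds.1 hs)
  set c : ℝ := ε / (2 * (‖e‖ + 1)) with hc
  have hcpos : 0 < c := by positivity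
  have h1 : s + c • e ∈ R := by
    apply hball
    rw [mem_ball_iff_norm, add_sub_cancel_left, norm_smul, Real.norm_of_nonneg hcpos.le, hc,
      div_mul_eq_mul_div, div_lt_iff₀ (by positivity)]
    nlinarith [norm_nonneg e]
  have h2 := hR.add_mem h1 hs'
  rw [add_neg_cancel_comm] at h2
  have h3 := hR.2.2 c⁻¹ (by positivity) _ h2
  rwa [inv_smul_smul₀ hcpos.ne'] at h3

/-- An invariant convex cone with an interior point in the domain of the data cone is the whole
space: the equation `lam X v - Y v = s` with `X v ∈ R` can be continued from large `lam` down
to `lam = 0`. -/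
theorem eq_univ_of_dataCone_invariant {n T : ℕ} {X Y : Matrix (Fin n) (Fin T) ℝ}
    (hspec : ∀ lam : ℝ, 0 ≤ lam → ∀ ξ : Fin n → ℝ, Matrix.vecMul ξ (Y - lam • X) ≤ 0 → ξ = 0)
    {R : Set (Fin n → ℝ)} (hR : IsConvexCone R)
    (hinv : ∀ v : Fin T → ℝ, 0 ≤ v → X.mulVec v ∈ R → Y.mulVec v ∈ R)
    {v₀ : Fin T → ℝ} (hv₀ : 0 ≤ v₀) (hint : X.mulVec v₀ ∈ interior R) : R = Set.univ := by
  -- For small `t > 0` the point `X v₀ - t Y v₀` is still interior; rescale by `Λ = t⁻¹`.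
  obtain ⟨Λ, hΛ, hs⟩ : ∃ Λ : ℝ, 0 < Λ ∧ Λ • X.mulVec v₀ - Y.mulVec v₀ ∈ interior R := by
    have htend : Filter.Tendsto (fun t : ℝ => X.mulVec v₀ - t • Y.mulVec v₀)
        (nhdsWithin 0 (Set.Ioi 0)) (nhds (X.mulVec v₀)) := by
      have : Continuous fun t : ℝ => X.mulVec v₀ - t • Y.mulVec v₀ := by fun_prop
      have h := this.tendsto 0
      simp only [zero_smul, sub_zero] at h
      exact h.mono_left nhdsWithin_le_nhds
    obtain ⟨t, ht, htpos⟩ := ((htend.eventually (isOpen_interior.mem_nhds hint)).and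
      self_mem_nhdsWithin).exists
    have htpos : 0 < t := htpos
    refine ⟨t⁻¹, inv_pos.2 htpos, ?_⟩
    have hsub : t⁻¹ • R ⊆ R := by
      rintro _ ⟨x, hx, rfl⟩
      exact hR.2.2 _ (inv_pos.2 htpos).le x hx
    apply interior_mono hsub
    rw [interior_smul₀ (inv_pos.2 htpos).ne']
    refine ⟨_, ht, ?_⟩
    simp only [smul_sub]
    rw [inv_smul_smul₀ htpos.ne']
  set s := Λ • X.mulVec v₀ - Y.mulVec v₀ with hs_def
  obtain ⟨c, hc, hball⟩ := Metric.mem_nhds_iff.1 (mem_interior_iff_mem_nhds.1 hs)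
  obtain ⟨C, hC, hsol⟩ := exists_bound_nonneg_solution hspec Λ
  set M := ‖X.mulVec v₀‖ * Real.exp (C * Λ) with hM
  -- `M` bounds `‖X v‖` along the whole continuation; `N` steps of size `δ = Λ / N` keep each
  -- perturbation of `s` inside the ball of radius `c`.
  obtain ⟨N, hN⟩ := exists_nat_gt (Λ * (C * (Λ * M)) / c)
  have hM0 : 0 ≤ M := by positivity
  have hN0 : (0 : ℝ) < N := lt_of_le_of_lt (by positivity) hN
  set δ := Λ / N with hδ
  have hδ0 : 0 < δ := by positivity
  have hδN : N * δ = Λ := by rw [hδ]; field_simp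
  have hδc : Λ * (C * (δ * M)) < c := by
    rw [div_lt_iff₀ hc] at hN
    rw [hδ]
    calc Λ * (C * (Λ / N * M)) = Λ * (C * (Λ * M)) / N := by ring
      _ < c := by rwa [div_lt_iff₀ hN0, mul_comm c]
  have key : ∀ k : ℕ, k ≤ N → ∃ v : Fin T → ℝ, 0 ≤ v ∧ X.mulVec v ∈ R ∧
      (Λ - k * δ) • X.mulVec v - Y.mulVec v = s ∧
      ‖X.mulVec v‖ ≤ ‖X.mulVec v₀‖ * Real.exp (C * (k * δ)) := by
    intro k
    induction k with
    | zero =>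
      intro _
      exact ⟨v₀, hv₀, interior_subset hint, by simp [hs_def], by simp⟩
    | succ k ih =>
      intro hk
      obtain ⟨v, hv, hvR, hvs, hvM⟩ := ih (by omega)
      have hkN : ((k : ℝ) + 1) * δ ≤ Λ := by
        rw [← hδN]
        refine mul_le_mul_of_nonneg_right ?_ hδ0.le
        exact_mod_cast hk
      have hkδ : 0 ≤ (k : ℝ) * δ := by positivity
      set lam := Λ - k * δ with hlam
      have hlam0 : 0 < lam := by rw [hlam]; linarith
      have hlamΛ : lam ≤ Λ := by rw [hlam]; linarith
      have hlam' : Λ - ((k + 1 : ℕ) : ℝ) * δ = lam - δ := by push_cast; rw [hlam]; ring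
      rw [hlam']
      -- Lowering `lam` by `δ` changes the left side by `-δ X v`; the correction `w` restores it.
      obtain ⟨w, hw, hwz, hwC⟩ := hsol (lam - δ) ⟨by rw [hlam]; linarith, by linarith⟩
        (δ • X.mulVec v)
      rw [Matrix.sub_mulVec, Matrix.smul_mulVec] at hwz
      rw [norm_smul, Real.norm_of_nonneg hδ0.le] at hwC
      have hvM' : ‖X.mulVec v‖ ≤ M := hvM.trans (by
        rw [hM]
        gcongr
        linarith)
      refine ⟨v + w, add_nonneg hv hw, ?_, ?_, ?_⟩
      -- `lam X(v + w) = Y v + (s + lam X w)`: the first term lies in `R` by invariance, the second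
      -- by closeness to `s`.
      · have hsw : s + lam • X.mulVec w ∈ R := by
          apply hball
          rw [mem_ball_iff_norm, add_sub_cancel_left, norm_smul, Real.norm_of_nonneg hlam0.le]
          refine lt_of_le_of_lt ?_ hδc
          gcongr
          exact hwC.trans (by gcongr)
        have hmem := hR.2.2 lam⁻¹ (by positivity) _ (hR.add_mem (hinv v hv hvR) hsw)
        have heq : Y.mulVec v + (s + lam • X.mulVec w) = lam • X.mulVec (v + w) := by
          rw [← hvs, Matrix.mulVec_add, smul_add]
          abel
        rwa [heq, inv_smul_smul₀ hlam0.ne'] at hmem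
      · rw [← hvs, Matrix.mulVec_add, Matrix.mulVec_add, smul_add]
        calc _ = (lam - δ) • X.mulVec v - Y.mulVec v
              + ((lam - δ) • X.mulVec w - Y.mulVec w) := by abel
          _ = _ := by rw [hwz, sub_smul]; abel
      · rw [Matrix.mulVec_add]
        calc ‖X.mulVec v + X.mulVec w‖ ≤ ‖X.mulVec v‖ + C * (δ * ‖X.mulVec v‖) :=
              (norm_add_le _ _).trans (by gcongr)
          _ = ‖X.mulVec v‖ * (C * δ + 1) := by ring
          _ ≤ (‖X.mulVec v₀‖ * Real.exp (C * (k * δ))) * Real.exp (C * δ) := by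
              gcongr
              exact Real.add_one_le_exp _
          _ = _ := by
              rw [mul_assoc, ← Real.exp_add]
              congr 2
              push_cast
              ring
  obtain ⟨v, hv, hvR, hvs, -⟩ := key N le_rfl
  rw [hδN, sub_self, zero_smul, zero_sub] at hvs
  refine hR.eq_univ_of_neg_interior_mem hs ?_
  rw [← hvs, neg_neg]
  exact hinv v hv hvR

/-! ### Invariant cones, their span and interior -/

theorem isConvexCone_iUnion_reachIter {n : ℕ} {G : Set ((Fin n → ℝ) × (Fin n → ℝ))}
    (hG : IsConvexCone G) : IsConvexCone (⋃ k, reachIter G k) := by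
  have hmono := reachIter_monotone hG.zero_mem
  refine isConvexCone_of_add_smul (Set.mem_iUnion.2 ⟨0, rfl⟩) ?_ ?_
  · intro x hx y hy
    obtain ⟨i, hi⟩ := Set.mem_iUnion.1 hx
    obtain ⟨j, hj⟩ := Set.mem_iUnion.1 hy
    exact Set.mem_iUnion.2 ⟨max i j, reachIter_add (fun _ hp _ hq => hG.add_mem hp hq) _
      (hmono (le_max_left i j) hi) (hmono (le_max_right i j) hj)⟩
  · intro ρ hρ x hx
    obtain ⟨i, hi⟩ := Set.mem_iUnion.1 hx
    exact Set.mem_iUnion.2 ⟨i, reachIter_smul (hG.2.2 ρ hρ) _ hi⟩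

theorem IsConvexCone.exists_sub_of_mem_span {E : Type*} [AddCommGroup E] [Module ℝ E] {R : Set E}
    (hR : IsConvexCone R) {x : E} (hx : x ∈ Submodule.span ℝ R) :
    ∃ a ∈ R, ∃ b ∈ R, x = a - b := by
  induction hx using Submodule.span_induction with
  | mem x hx => exact ⟨x, hx, 0, hR.zero_mem, (sub_zero x).symm⟩
  | zero => exact ⟨0, hR.zero_mem, 0, hR.zero_mem, (sub_zero 0).symm⟩
  | add x y _ _ hx hy =>
    obtain ⟨a, ha, b, hb, rfl⟩ := hx
    obtain ⟨c, hc, d, hd, rfl⟩ := hy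
    exact ⟨a + c, hR.add_mem ha hc, b + d, hR.add_mem hb hd, by abel⟩
  | smul r x _ hx =>
    obtain ⟨a, ha, b, hb, rfl⟩ := hx
    rcases le_total 0 r with hr | hr
    · exact ⟨r • a, hR.2.2 r hr a ha, r • b, hR.2.2 r hr b hb, smul_sub _ _ _⟩
    · refine ⟨(-r) • b, hR.2.2 _ (neg_nonneg.2 hr) b hb, (-r) • a,
        hR.2.2 _ (neg_nonneg.2 hr) a ha, ?_⟩
      rw [smul_sub, neg_smul, neg_smul]
      abel

theorem IsConvexCone.interior_nonempty {n : ℕ} {R : Set (Fin n → ℝ)} (hR : IsConvexCone R)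
    (hspan : Submodule.span ℝ R = ⊤) : (interior R).Nonempty := by
  rw [hR.2.1.interior_nonempty_iff_affineSpan_eq_top, ← Set.insert_eq_of_mem hR.zero_mem]
  apply SetLike.coe_injective
  rw [affineSpan_insert_zero, hspan]
  rfl

section Sufficiency

variable {n T : ℕ} {X Y : Matrix (Fin n) (Fin T) ℝ} {R N : Set (Fin n → ℝ)}

/-- The span of an invariant convex cone is invariant under the linear hull of the data, provided
the domain of the data cone and a symmetric part `N` of the cone generate the state space. -/
theorem mulVec_mem_span_of_invariant (hR : IsConvexCone R) (hN : N ⊆ R) (hN' : ∀ s ∈ N, -s ∈ N)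
    (hdom : ∀ x, ∃ v : Fin T → ℝ, 0 ≤ v ∧ ∃ s ∈ N, X.mulVec v + s = x)
    (hinv : ∀ v : Fin T → ℝ, 0 ≤ v → X.mulVec v ∈ R → Y.mulVec v ∈ R)
    (v : Fin T → ℝ) (hv : X.mulVec v ∈ Submodule.span ℝ R) :
    Y.mulVec v ∈ Submodule.span ℝ R := by
  have hsub : ∀ x ∈ R, x ∈ Submodule.span ℝ R := fun x hx => Submodule.subset_span hx
  have hnonneg : ∀ v : Fin T → ℝ, 0 ≤ v → X.mulVec v ∈ Submodule.span ℝ R →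
      Y.mulVec v ∈ Submodule.span ℝ R := by
    intro v hv0 hv
    obtain ⟨a, ha, b, hb, hab⟩ := hR.exists_sub_of_mem_span hv
    -- With `X v = a - b` and `X w = b - s`, both `X w` and `X (v + w) = a - s` lie in `R`, so `Y v`
    -- is a difference of elements of `R`.
    obtain ⟨w, hw, s, hs, hws⟩ := hdom b
    have hwR : X.mulVec w ∈ R := by
      rw [eq_sub_of_add_eq hws, sub_eq_add_neg]
      exact hR.add_mem hb (hN (hN' s hs))
    have hvwR : X.mulVec (v + w) ∈ R := by
      rw [Matrix.mulVec_add, hab, eq_sub_of_add_eq hws, sub_add_sub_cancel, sub_eq_add_neg]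
      exact hR.add_mem ha (hN (hN' s hs))
    have h := Submodule.sub_mem _ (hsub _ (hinv _ (add_nonneg hv0 hw) hvwR))
      (hsub _ (hinv w hw hwR))
    rwa [Matrix.mulVec_add, add_sub_cancel_right] at h
  -- The shift `d` brings `X (v⁺ + d)` into `N`; then `v` is a difference of two nonnegative vectors
  -- whose images under `X` lie in the span.
  obtain ⟨d, hd, s, hs, hds⟩ := hdom (-X.mulVec v⁺)
  have hpos : X.mulVec (v⁺ + d) ∈ R := by
    rw [Matrix.mulVec_add, eq_sub_of_add_eq hds, add_sub, add_neg_cancel, zero_sub]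
    exact hN (hN' s hs)
  have hsplit : v⁺ + d - (v⁻ + d) = v := by
    rw [add_sub_add_right_eq_sub]
    exact posPart_sub_negPart v
  have hneg : X.mulVec (v⁻ + d) ∈ Submodule.span ℝ R := by
    have : v⁻ + d = v⁺ + d - v := by rw [eq_sub_iff_add_eq, ← eq_sub_iff_add_eq', hsplit]
    rw [this, Matrix.mulVec_sub]
    exact Submodule.sub_mem _ (hsub _ hpos) hv
  have h := Submodule.sub_mem _ (hsub _ (hinv _ (add_nonneg (posPart_nonneg v) hd) hpos))
    (hnonneg _ (add_nonneg (negPart_nonneg v) hd) hneg)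
  rwa [← Matrix.mulVec_sub, hsplit] at h

theorem eq_univ_of_invariant_of_spectral (hR : IsConvexCone R) (hN : N ⊆ R)
    (hN' : ∀ s ∈ N, -s ∈ N)
    (hdom : ∀ x, ∃ v : Fin T → ℝ, 0 ≤ v ∧ ∃ s ∈ N, X.mulVec v + s = x)
    (hinv : ∀ v : Fin T → ℝ, 0 ≤ v → X.mulVec v ∈ R → Y.mulVec v ∈ R) {k : ℕ}
    (hreach : iterImagePreimage Y X k = Set.univ)
    (hspec : ∀ lam : ℝ, 0 ≤ lam → ∀ ξ : Fin n → ℝ, Matrix.vecMul ξ (Y - lam • X) ≤ 0 → ξ = 0) :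
    R = Set.univ := by
  have hspan : Submodule.span ℝ R = ⊤ := by
    rw [eq_top_iff, ← SetLike.coe_subset_coe, Submodule.top_coe, ← hreach,
      iterImagePreimage_eq_reachIter]
    refine reachIter_subset (Submodule.zero_mem _) ?_ k
    rintro x hx y ⟨v, hv⟩
    obtain ⟨rfl, rfl⟩ := Prod.mk.inj hv
    exact mulVec_mem_span_of_invariant hR hN hN' hdom hinv v hx
  obtain ⟨r, hr⟩ := hR.interior_nonempty hspan
  obtain ⟨v, hv, s, hs, hvs⟩ := hdom r
  refine eq_univ_of_dataCone_invariant hspec hR hinv hv ?_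
  have hRR : R + R ⊆ R := by
    rintro _ ⟨a, ha, b, hb, rfl⟩
    exact hR.add_mem ha hb
  -- `X v = r + (-s)` stays interior, since translating by `-s ∈ R` maps `R` into itself.
  rw [eq_sub_of_add_eq hvs, sub_eq_add_neg]
  exact interior_mono hRR (subset_interior_add_left ⟨r, hr, -s, hN (hN' s hs), rfl⟩)

end Sufficiency

/-! ### Test processes for necessity -/

section Necessity

variable {n T : ℕ} {D : Finset ((Fin n → ℝ) × (Fin n → ℝ))} {X Y : Matrix (Fin n) (Fin T) ℝ}

theorem eq_zero_of_vecMul_nonpos_of_informative (hXY : IsDataMatrices D X Y)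
    (hD : InformativeForReachability (D : Set ((Fin n → ℝ) × (Fin n → ℝ)))) {lam : ℝ}
    (hlam : 0 ≤ lam) {ξ : Fin n → ℝ} (hξ : Matrix.vecMul ξ (Y - lam • X) ≤ 0) : ξ = 0 := by
  let H : SetValuedMap n := fun x => {y | ξ ⬝ᵥ y ≤ lam * (ξ ⬝ᵥ x)}
  have hconv : H.IsConvexProc := by
    refine isConvexCone_of_add_smul ?_ ?_ ?_
    · change ξ ⬝ᵥ 0 ≤ lam * (ξ ⬝ᵥ 0)
      simp
    · rintro ⟨a, b⟩ hab ⟨c, d⟩ hcd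
      change ξ ⬝ᵥ (b + d) ≤ lam * (ξ ⬝ᵥ (a + c))
      rw [dotProduct_add, dotProduct_add, mul_add]
      exact add_le_add hab hcd
    · rintro ρ hρ ⟨a, b⟩ hab
      change ξ ⬝ᵥ (ρ • b) ≤ lam * (ξ ⬝ᵥ (ρ • a))
      rw [dotProduct_smul, dotProduct_smul, smul_eq_mul, smul_eq_mul, mul_left_comm]
      exact mul_le_mul_of_nonneg_left hab hρ
  have hDH : (D : Set ((Fin n → ℝ) × (Fin n → ℝ))) ⊆ H.graph := by
    rw [hXY.2]
    rintro _ ⟨t, rfl⟩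
    have h := hξ t
    rw [Matrix.vecMul_sub, Matrix.vecMul_smul] at h
    exact sub_nonpos.1 h
  have hfeas := SetValuedMap.feasibleSet_eq_univ (H := H) fun x => ⟨lam • x, by
    change ξ ⬝ᵥ (lam • x) ≤ lam * (ξ ⬝ᵥ x)
    rw [dotProduct_smul, smul_eq_mul]⟩
  have hreach : H.reachableSet ⊆ {x | ξ ⬝ᵥ x ≤ 0} :=
    SetValuedMap.reachableSet_subset (by simp) fun x hx y hy =>
      le_trans hy (mul_nonpos_of_nonneg_of_nonpos hlam hx)
  have hmem : ξ ⬝ᵥ ξ ≤ 0 := hreach (hD H hconv hDH (hfeas ▸ Set.mem_univ ξ))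
  exact dotProduct_self_eq_zero.1
    (le_antisymm hmem (Finset.sum_nonneg fun i _ => mul_self_nonneg (ξ i)))

theorem iterImagePreimage_eq_univ_of_informative (hXY : IsDataMatrices D X Y)
    (hD : InformativeForReachability (D : Set ((Fin n → ℝ) × (Fin n → ℝ))))
    (hdom : ∀ x, ∃ v : Fin T → ℝ, ∃ s ∈ iterImagePreimage Y X n, X.mulVec v + s = x) :
    iterImagePreimage Y X n = Set.univ := by
  let L : Submodule ℝ ((Fin n → ℝ) × (Fin n → ℝ)) :=
    LinearMap.range (X.mulVecLin.prod Y.mulVecLin)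
  let P := reachSubmodule L n
  have hP : (P : Set (Fin n → ℝ)) = iterImagePreimage Y X n := by
    rw [coe_reachSubmodule, iterImagePreimage_eq_reachIter]
    rfl
  have hLP : ∀ x ∈ P, ∀ y, (x, y) ∈ L → y ∈ P := by
    intro x hx y hxy
    have : y ∈ reachSubmodule L (n + 1) := ⟨(x, y), ⟨⟨hx, trivial⟩, hxy⟩, rfl⟩
    rwa [reachSubmodule_succ_eq] at this
  -- Adding `P × P` makes every value nonempty, as `(s, 0)` is now allowed for `s ∈ P`, without
  -- letting trajectories leave `P`.
  let H : SetValuedMap n := fun x => {y | (x, y) ∈ L ⊔ P.prod P}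
  have hconv : H.IsConvexProc := isConvexCone_of_add_smul (L ⊔ P.prod P).zero_mem
    (fun _ hx _ hy => (L ⊔ P.prod P).add_mem hx hy) fun ρ _ _ hx => (L ⊔ P.prod P).smul_mem ρ hx
  have hDH : (D : Set ((Fin n → ℝ) × (Fin n → ℝ))) ⊆ H.graph := by
    rw [hXY.2]
    rintro _ ⟨t, rfl⟩
    refine Submodule.mem_sup_left ⟨Pi.single t 1, ?_⟩
    simp
  have hfeas := SetValuedMap.feasibleSet_eq_univ (H := H) fun x => by
    obtain ⟨v, s, hs, rfl⟩ := hdom x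
    rw [← hP] at hs
    refine ⟨Y.mulVec v, ?_⟩
    have := Submodule.add_mem_sup (S := L) (T := P.prod P) ⟨v, rfl⟩
      (show (s, (0 : Fin n → ℝ)) ∈ P.prod P from ⟨hs, P.zero_mem⟩)
    rw [Prod.mk_add_mk, add_zero] at this
    exact this
  have hreach : H.reachableSet ⊆ P := by
    refine SetValuedMap.reachableSet_subset P.zero_mem fun x hx y hy => ?_
    obtain ⟨⟨a, b⟩, hab, ⟨c, d⟩, ⟨hc, hd⟩, hsum⟩ := Submodule.mem_sup.1 hy
    obtain ⟨rfl, rfl⟩ := Prod.mk.inj hsum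
    exact P.add_mem (hLP a ((Submodule.add_mem_iff_left _ hc).1 hx) b hab) hd
  rw [← hP]
  exact Set.eq_univ_of_forall fun ξ => hreach (hD H hconv hDH (hfeas ▸ Set.mem_univ ξ))

end Necessity

/-! ### The characterisation -/

theorem theorem5 {n T l : ℕ} (D : Finset ((Fin n → ℝ) × (Fin n → ℝ)))
    (X Y : Matrix (Fin n) (Fin T) ℝ) (hXY : IsDataMatrices D X Y)
    (Z W : Matrix (Fin l) (Fin n) ℝ)
    (hZW : IsDualMatrices (D : Set ((Fin n → ℝ) × (Fin n → ℝ))) Z W)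
    (hdom : imageOrthant X + iterPreimageImage W Z n = Set.univ) :
    InformativeForReachability (D : Set ((Fin n → ℝ) × (Fin n → ℝ))) ↔
      iterImagePreimage Y X n = Set.univ ∧
        ∀ lam : ℝ, 0 ≤ lam → ∀ ξ : Fin n → ℝ,
          Matrix.vecMul ξ (Y - lam • X) ≤ 0 → ξ = 0 := by
  have hdom' : ∀ x, ∃ v : Fin T → ℝ, 0 ≤ v ∧
      ∃ s ∈ iterPreimageImage W Z n, X.mulVec v + s = x := by
    intro x
    obtain ⟨_, ⟨v, hv, rfl⟩, s, hs, hx⟩ := hdom.symm ▸ Set.mem_univ x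
    exact ⟨v, hv, s, hs, hx⟩
  have hlin : {p | Z.mulVec p.1 = W.mulVec p.2} ⊆ dataCone X Y :=
    fun p hp => mem_dataCone_of_mulVec_eq hXY hZW hp
  constructor
  · intro hD
    refine ⟨iterImagePreimage_eq_univ_of_informative hXY hD fun x => ?_,
      fun lam hlam ξ hξ => eq_zero_of_vecMul_nonpos_of_informative hXY hD hlam hξ⟩
    obtain ⟨v, -, s, hs, hx⟩ := hdom' x
    refine ⟨v, s, ?_, hx⟩
    rw [iterImagePreimage_eq_reachIter]
    refine reachIter_mono_left (hlin.trans ?_) n hs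
    rintro _ ⟨w, -, rfl⟩
    exact ⟨w, rfl⟩
  · rintro ⟨hreach, hspec⟩ H hH hDH
    have hcone := dataCone_subset_of_isConvexCone hXY hH hDH
    -- All of `ℝⁿ` is reachable, which is more than reachability of the feasible states.
    have huniv : ⋃ k, reachIter H.graph k = Set.univ := by
      refine eq_univ_of_invariant_of_spectral (N := iterPreimageImage W Z n)
        (isConvexCone_iUnion_reachIter hH) ?_ ?_ hdom' ?_ hreach hspec
      · exact (reachIter_mono_left (hlin.trans hcone) n).trans (Set.subset_iUnion _ n)
      · intro s hs
        rw [iterPreimageImage_eq_reachIter] at hs ⊢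
        rw [← neg_one_smul ℝ s]
        refine reachIter_smul (fun p hp => ?_) n hs
        change Z.mulVec ((-1 : ℝ) • p.1) = W.mulVec ((-1 : ℝ) • p.2)
        rw [Matrix.mulVec_smul, Matrix.mulVec_smul, show Z.mulVec p.1 = W.mulVec p.2 from hp]
      · intro v hv hvR
        obtain ⟨k, hk⟩ := Set.mem_iUnion.1 hvR
        exact Set.mem_iUnion.2 ⟨k + 1, mem_reachIter_succ.2 ⟨_, hk, hcone ⟨v, hv, rfl⟩⟩⟩
    intro ξ _
    obtain ⟨k, hk⟩ := Set.mem_iUnion.1 (huniv.symm ▸ Set.mem_univ ξ)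
    exact H.reachIter_graph_subset_reachableSet k hk
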